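/- Let $d \geq 3$ be an odd integer, and suppose that there are primes $p, q$ dividing $d$ with $q \equiv 1 \bmod p$. Then there exist a number field $k$ and a diagonal surface $$S:\quad a_0x_0^d + a_1x_1^d + a_2x_2^d + a_3x_3^d = 0 \quad\text{in } \mathbb{P}^3_k, \qquad a_0,a_1,a_2,a_3 \in k^*,$$ of degree $d$ over $k$ which fails the Hasse principle for lines: for every place $v$ of $k$ (archimedean or not), with completion $k_v$, the surface $S_{k_v}$ contains a line defined over $k_v$, but $S$ contains no line defined over $k$. Moreover, one may take $k = \mathbb{Q}(\mu_{p^n})$, where $p^n$ is the exact power of $p$ dividing $d$. -/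

import Mathlib

open scoped NumberField

namespace DiagonalSurface

/-- The diagonal form `a₀ x₀ ^ d + a₁ x₁ ^ d + a₂ x₂ ^ d + a₃ x₃ ^ d` with non-zero coefficients. -/
noncomputable def diagonalForm {k : Type*} [Field k] (d : ℕ) (a : Fin 4 → kˣ) :
    MvPolynomial (Fin 4) k :=
  ∑ i, MvPolynomial.C (a i : k) * MvPolynomial.X i ^ d

/-- The surface `F = 0` in `ℙ³` contains the line `ℙ(V)` defined over `K`, for some
two-dimensional subspace `V` of `K⁴`. Containment is as schemes: `F (s u + t w)` is the zero
polynomial in the indeterminates `s = X 0`, `t = X 1` for all `u, w ∈ V`. -/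
def ContainsLine {K : Type*} [Field K] (F : MvPolynomial (Fin 4) K) : Prop :=
  ∃ V : Submodule K (Fin 4 → K), Module.finrank K V = 2 ∧
    ∀ u ∈ V, ∀ w ∈ V,
      MvPolynomial.aeval
        (fun i : Fin 4 =>
          (MvPolynomial.C (u i) * MvPolynomial.X 0 + MvPolynomial.C (w i) * MvPolynomial.X 1 :
            MvPolynomial (Fin 2) K)) F = 0

/-- The base change to the `k`-algebra `K` of the surface `F = 0` contains a line over `K`. -/
def HasLineOver {k : Type*} [Field k] (F : MvPolynomial (Fin 4) k)
    (K : Type*) [Field K] [Algebra k K] : Prop :=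
  ContainsLine (MvPolynomial.map (algebraMap k K) F)

/-- The surface `F = 0` over the number field `k` fails the Hasse principle for lines: it contains
a line over every completion of `k` (archimedean and non-archimedean), but no line over `k`. -/
def FailsHasseForLines {k : Type*} [Field k] [NumberField k] (F : MvPolynomial (Fin 4) k) : Prop :=
  (∀ v : NumberField.InfinitePlace k, HasLineOver F v.Completion) ∧
  (∀ v : IsDedekindDomain.HeightOneSpectrum (𝓞 k), HasLineOver F (v.adicCompletion k)) ∧
  ¬ HasLineOver F k

end DiagonalSurface

/-!
A line on a diagonal surface of odd degree `d ≥ 3` in characteristic zero pairs up the four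
coordinates: it is given by `x_j = -c x_i`, `x_l = -e x_k`, where the coefficients satisfy
`a_i = a_j c ^ d` and `a_k = a_l e ^ d`. Indeed, restricting the coordinates to the line gives four
linear forms in two variables whose `d`-th powers are linearly dependent, and three directional
derivatives suffice to isolate any one of the powers unless its form is proportional to another
(`exists_proportional_of_sum_eq_zero`, `exists_perm_of_containsLine`). Consequently, for odd `d`,
the surface with coefficients `1, x, y, xy` has a line over `K` if and only if `x` or `y` is a
`d`-th power in `K`. It remains to find `x, y ∈ k = ℚ(μ_{p^n})` that are not `d`-th powers, but
such that in each completion one of them is.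

Since `p ∣ q - 1 = [k(μ_q) : k]`, and `k` contains the `p`-th roots of unity, some `θ ∈ k` is a
`p`-th power in `k(μ_q)` but not in `k` (`exists_pow_mem_not_pow`). Let `ℓ ≡ 1 mod q³` be a prime
number and put `x = θ ^ (d / p)`, `y = ℓ ^ (d / q)`.

* Locally, if `k_v` contains the `q`-th roots of unity, then `k(μ_q)` embeds into `k_v`, so `θ` is
  a `p`-th power and `x` a `d`-th power in `k_v`. Otherwise `ℓ` is a `q`-th power and `y` a `d`-th
  power in `k_v`: at an infinite place because `ℓ > 0`; at `v ∣ q` because `ℓ` is close to `1`; at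
  the other places because `ℓ` is a unit and every unit is a `q`-th power in the residue field
  (`exists_pow_eq_or_exists_primitiveRoot`).
* Globally, `x` is not a `d`-th power because `k` contains the `p^n`-th roots of unity
  (`exists_pow_eq_of_pow_eq`), and `y` is not one because its norm would force `q` to divide
  `[k : ℚ] = p ^ (n - 1) (p - 1)`, while `q > p` (`dvd_finrank_of_pow_eq`).
-/

namespace DiagonalSurface

/-! ### Lines on diagonal surfaces -/

open MvPolynomial in
/-- Applying the directional derivative `v₀ ∂/∂s + v₁ ∂/∂t` to a vanishing combination of powers
of linear forms lowers the exponent by one and multiplies each term by the value of its form at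
`v`. -/
theorem sum_mul_pow_eq_zero_of_succ {ι K : Type*} [Fintype ι] [Field K] [CharZero K] (u w c : ι → K)
    (m : ℕ)
    (h : ∑ i, C (c i) * (C (u i) * X 0 + C (w i) * X 1 : MvPolynomial (Fin 2) K) ^ (m + 1) = 0)
    (v₀ v₁ : K) :
    ∑ i, C (c i * (u i * v₀ + w i * v₁)) *
      (C (u i) * X 0 + C (w i) * X 1 : MvPolynomial (Fin 2) K) ^ m = 0 := by
  have h0 := congrArg (pderiv (0 : Fin 2)) h
  have h1 := congrArg (pderiv (1 : Fin 2)) h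
  have e10 : pderiv (0 : Fin 2) (X 1 : MvPolynomial (Fin 2) K) = 0 := pderiv_X_of_ne (by decide)
  have e01 : pderiv (1 : Fin 2) (X 0 : MvPolynomial (Fin 2) K) = 0 := pderiv_X_of_ne (by decide)
  simp only [map_sum, Derivation.leibniz, Derivation.leibniz_pow, map_add, pderiv_C, pderiv_X_self,
    e10, e01, smul_eq_mul, map_zero, mul_zero, add_zero, zero_add, mul_one, Nat.add_sub_cancel,
    nsmul_eq_mul] at h0 h1
  have hm : ((m + 1 : ℕ) : MvPolynomial (Fin 2) K) ≠ 0 := Nat.cast_ne_zero.mpr (by lia)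
  refine (mul_eq_zero.mp ?_).resolve_left hm
  have h2 := congrArg₂ (fun x y => C v₀ * x + C v₁ * y) h0 h1
  simp only [mul_zero, add_zero] at h2
  rw [← h2]
  simp only [Finset.mul_sum, ← Finset.sum_add_distrib]
  refine Finset.sum_congr rfl fun i _ => ?_
  simp only [map_mul, map_add]
  ring

open MvPolynomial in
/-- Four powers of linear forms of exponent at least three are linearly independent unless two of
the forms are proportional: a nonzero form occurring in a vanishing combination has a nonzero
partner proportional to it. -/
theorem exists_proportional_of_sum_eq_zero {K : Type*} [Field K] [CharZero K] (a u w : Fin 4 → K)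
    (ha : ∀ i, a i ≠ 0) {d : ℕ} (hd : 3 ≤ d)
    (h : ∑ i, C (a i) * (C (u i) * X 0 + C (w i) * X 1 : MvPolynomial (Fin 2) K) ^ d = 0)
    (i : Fin 4) (hi : u i ≠ 0 ∨ w i ≠ 0) :
    ∃ j, j ≠ i ∧ (u j ≠ 0 ∨ w j ≠ 0) ∧ u i * w j = w i * u j := by
  by_contra! hcon
  -- a vector killed by the `j`-th form but not by the `i`-th one
  have key : ∀ j, ∃ v : K × K, u i * v.1 + w i * v.2 ≠ 0 ∧
      (j ≠ i → u j * v.1 + w j * v.2 = 0) := by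
    intro j
    by_cases hj : u j ≠ 0 ∨ w j ≠ 0
    · by_cases hji : j = i
      · rcases hi with hi | hi
        · exact ⟨(1, 0), by simpa using hi, fun h => absurd hji h⟩
        · exact ⟨(0, 1), by simpa using hi, fun h => absurd hji h⟩
      · refine ⟨(w j, -u j), fun h0 => hcon j hji hj ?_, fun _ => by ring⟩
        linear_combination h0
    · push Not at hj
      rcases hi with hi | hi
      · exact ⟨(1, 0), by simpa using hi, fun _ => by simp [hj]⟩
      · exact ⟨(0, 1), by simpa using hi, fun _ => by simp [hj]⟩
  choose v hv hv0 using key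
  obtain ⟨m, rfl⟩ : ∃ m, d = m + 1 + 1 + 1 := ⟨d - 3, by lia⟩
  -- the three derivatives kill every term but the `i`-th
  have h3 := sum_mul_pow_eq_zero_of_succ u w _ _ (sum_mul_pow_eq_zero_of_succ u w _ _
    (sum_mul_pow_eq_zero_of_succ u w _ _ h (v (i + 1)).1 (v (i + 1)).2)
    (v (i + 2)).1 (v (i + 2)).2) (v (i + 3)).1 (v (i + 3)).2
  rw [Finset.sum_eq_single i] at h3
  · rcases mul_eq_zero.mp h3 with h3 | h3
    · rw [map_eq_zero_iff C (C_injective _ _)] at h3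
      exact mul_ne_zero (mul_ne_zero (mul_ne_zero (ha i) (hv _)) (hv _)) (hv _) h3
    · have h4 := congrArg (eval ![(v 0).1, (v 0).2]) (eq_zero_of_pow_eq_zero h3)
      simp at h4
      exact hv 0 h4
  · intro j _ hj
    have : j = i + 1 ∨ j = i + 2 ∨ j = i + 3 := by
      clear * - hj
      revert i j
      decide
    rcases this with rfl | rfl | rfl <;> simp [hv0 _ hj]
  · simp

/-- `x = y * c ^ d` for some `c`: for nonzero `x` and `y`, they agree in `Kˣ ⧸ (Kˣ) ^ d`. -/
def PowRel {K : Type*} [Field K] (d : ℕ) (x y : K) : Prop := ∃ c : K, x = y * c ^ d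

theorem PowRel.symm {K : Type*} [Field K] {d : ℕ} {x y : K} (hd : d ≠ 0) (hx : x ≠ 0)
    (h : PowRel d x y) : PowRel d y x := by
  obtain ⟨c, rfl⟩ := h
  have hc : c ≠ 0 := by rintro rfl; simp [hd] at hx
  exact ⟨c⁻¹, by rw [mul_assoc, ← mul_pow, mul_inv_cancel₀ hc, one_pow, mul_one]⟩

theorem powRel_of_add_eq_zero {K : Type*} [Field K] {d : ℕ} (hd : Odd d) {x y s t : K} (hs : s ≠ 0)
    (h : x * s ^ d + y * t ^ d = 0) : PowRel d x y := by
  refine ⟨-(t / s), ?_⟩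
  rw [hd.neg_pow, div_pow]
  have := pow_ne_zero d hs
  field_simp
  linear_combination h

open MvPolynomial in
/-- A line on a diagonal surface of degree `d` splits the coordinates into two pairs, along each
of which the two coefficients agree up to a `d`-th power. -/
theorem exists_perm_of_containsLine {K : Type*} [Field K] [CharZero K] {d : ℕ} (hd : 3 ≤ d)
    (hodd : Odd d) (b : Fin 4 → K) (hb : ∀ i, b i ≠ 0)
    (h : ContainsLine (∑ i, C (b i) * X i ^ d : MvPolynomial (Fin 4) K)) :
    ∃ σ : Equiv.Perm (Fin 4), PowRel d (b (σ 0)) (b (σ 1)) ∧ PowRel d (b (σ 2)) (b (σ 3)) := by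
  obtain ⟨V, hV, hF⟩ := h
  have : FiniteDimensional K V := Module.finite_of_finrank_eq_succ hV
  let B := Module.finBasisOfFinrankEq K V hV
  have hli := (B.linearIndependent.map' V.subtype V.ker_subtype)
  obtain ⟨u, hu⟩ : ∃ u, u = (B 0 : Fin 4 → K) := ⟨_, rfl⟩
  obtain ⟨w, hw⟩ : ∃ w, w = (B 1 : Fin 4 → K) := ⟨_, rfl⟩
  have hli' : ∀ s t : K, s • u + t • w = 0 → s = 0 ∧ t = 0 := by
    rw [← LinearIndependent.pair_iff]
    convert! hli using 1
    ext i
    fin_cases i <;> simp [hu, hw]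
  have hs := hF u (hu ▸ (B 0).2) w (hw ▸ (B 1).2)
  simp only [map_sum, map_mul, map_pow, aeval_X, algHom_C, algebraMap_eq] at hs
  have partner := exists_proportional_of_sum_eq_zero b u w hb hd hs
  obtain ⟨i, hi⟩ : ∃ i, u i ≠ 0 ∨ w i ≠ 0 := by
    by_contra! hcon
    have := hli' 1 0 (by ext i; simp [hcon i])
    simp at this
  obtain ⟨j, hji, hj, hij⟩ := partner i hi
  obtain ⟨k, hik⟩ : ∃ k, u i * w k ≠ w i * u k := by
    by_contra! hcon
    have := hli' (-w i) (u i) (by ext k; simp; linear_combination hcon k)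
    simp only [neg_eq_zero] at this
    tauto
  have hk : u k ≠ 0 ∨ w k ≠ 0 := by
    by_contra! hcon
    simp [hcon] at hik
  obtain ⟨l, hlk, hl, hkl⟩ := partner k hk
  -- proportionality to the nonzero form `n` is transitive
  have trans : ∀ m n r, (u n ≠ 0 ∨ w n ≠ 0) → u m * w n = w m * u n → u n * w r = w n * u r →
      u m * w r = w m * u r := by
    intro m n r hn h1 h2
    rcases hn with hn | hn
    · apply mul_left_cancel₀ hn
      linear_combination u m * h2 + u r * h1
    · apply mul_left_cancel₀ hn
      linear_combination w r * h1 + w m * h2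
  have hki : k ≠ i := by rintro rfl; exact hik (mul_comm _ _)
  have hkj : k ≠ j := by rintro rfl; exact hik hij
  have hil : u i * w l ≠ w i * u l := fun h0 =>
    hik (trans i l k hl h0 (by linear_combination -hkl))
  have hli : l ≠ i := by rintro rfl; exact hil (mul_comm _ _)
  have hlj : l ≠ j := by rintro rfl; exact hil hij
  have hjk : u j * w k ≠ w j * u k := fun h0 => hik (trans i j k hj hij h0)
  have hinj : Function.Injective ![i, j, k, l] := by
    intro m n
    fin_cases m <;> fin_cases n <;> simp [hji, hki, hkj, hli, hlj, hlk, hji.symm, hki.symm,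
      hkj.symm, hli.symm, hlj.symm, hlk.symm]
  let σ := Equiv.ofBijective _ (Finite.injective_iff_bijective.mp hinj)
  have heval : ∀ s t : K, b i * (u i * s + w i * t) ^ d + b j * (u j * s + w j * t) ^ d +
      b k * (u k * s + w k * t) ^ d + b l * (u l * s + w l * t) ^ d = 0 := by
    intro s t
    rw [← Equiv.sum_comp σ, Fin.sum_univ_four] at hs
    have := congrArg (eval ![s, t]) hs
    simpa [σ] using this
  have hd0 : d ≠ 0 := by lia
  have e1 := heval (w k) (-u k)
  have e2 := heval (w i) (-u i)
  rw [show u k * w k + w k * -u k = 0 by ring,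
    show u l * w k + w l * -u k = 0 by linear_combination -hkl, zero_pow hd0] at e1
  rw [show u i * w i + w i * -u i = 0 by ring,
    show u j * w i + w j * -u i = 0 by linear_combination -hij, zero_pow hd0] at e2
  refine ⟨σ, powRel_of_add_eq_zero hodd (s := u i * w k + w i * -u k)
    (t := u j * w k + w j * -u k) (fun h0 => hik (by linear_combination h0)) ?_,
    powRel_of_add_eq_zero hodd (s := u k * w i + w k * -u i)
    (t := u l * w i + w l * -u i) (fun h0 => hik (by linear_combination -h0)) ?_⟩
  · simpa [σ] using e1
  · simpa [σ] using e2

open MvPolynomial in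
/-- Conversely, such a splitting gives the line `x_{σ 1} = -c x_{σ 0}`, `x_{σ 3} = -e x_{σ 2}`. -/
theorem containsLine_of_perm {K : Type*} [Field K] {d : ℕ} (hodd : Odd d) (b : Fin 4 → K)
    (σ : Equiv.Perm (Fin 4)) (h₁ : PowRel d (b (σ 0)) (b (σ 1)))
    (h₂ : PowRel d (b (σ 2)) (b (σ 3))) :
    ContainsLine (∑ i, C (b i) * X i ^ d : MvPolynomial (Fin 4) K) := by
  obtain ⟨c, hc⟩ := h₁
  obtain ⟨e, he⟩ := h₂
  let f : (Fin 2 → K) →ₗ[K] (Fin 4 → K) :=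
    { toFun := fun z i => ![z 0, -c * z 0, z 1, -e * z 1] (σ.symm i)
      map_add' := fun y z => by
        ext i
        generalize hm : σ.symm i = m
        fin_cases m <;> simp [hm] <;> ring
      map_smul' := fun r z => by
        ext i
        generalize hm : σ.symm i = m
        fin_cases m <;> simp [hm] <;> ring }
  have f0 : ∀ z, f z (σ 0) = z 0 := fun z => by simp [f]
  have f1 : ∀ z, f z (σ 1) = -c * z 0 := fun z => by simp [f]
  have f2 : ∀ z, f z (σ 2) = z 1 := fun z => by simp [f]
  have f3 : ∀ z, f z (σ 3) = -e * z 1 := fun z => by simp [f]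
  have hf : Function.Injective f := by
    intro y z hyz
    ext i
    fin_cases i
    · simpa [f0] using congrFun hyz (σ 0)
    · simpa [f2] using congrFun hyz (σ 2)
  refine ⟨LinearMap.range f, by simp [LinearMap.finrank_range_of_inj hf], ?_⟩
  rintro _ ⟨y, rfl⟩ _ ⟨z, rfl⟩
  simp only [map_sum, map_mul, map_pow, aeval_X, algHom_C, algebraMap_eq]
  rw [← Equiv.sum_comp σ, Fin.sum_univ_four, hc, he]
  simp only [f0, f1, f2, f3]
  have e1 : (C (-c * y 0) * X 0 + C (-c * z 0) * X 1 : MvPolynomial (Fin 2) K) ^ d =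
      -(C (c ^ d) * (C (y 0) * X 0 + C (z 0) * X 1) ^ d) := by
    rw [map_pow, ← mul_pow, ← hodd.neg_pow]
    congr 1
    simp only [map_mul, map_neg]
    ring
  have e2 : (C (-e * y 1) * X 0 + C (-e * z 1) * X 1 : MvPolynomial (Fin 2) K) ^ d =
      -(C (e ^ d) * (C (y 1) * X 0 + C (z 1) * X 1) ^ d) := by
    rw [map_pow, ← mul_pow, ← hodd.neg_pow]
    congr 1
    simp only [map_mul, map_neg]
    ring
  rw [e1, e2]
  simp only [map_mul]
  ring

/-- The coefficients `1, x, y, xy`. -/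
def productCoeffs {k : Type*} [Field k] (x y : kˣ) : Fin 4 → kˣ := ![1, x, y, x * y]

open MvPolynomial in
theorem map_diagonalForm_productCoeffs {k : Type*} [Field k] (d : ℕ) (x y : kˣ) (K : Type*)
    [Field K] [Algebra k K] :
    map (algebraMap k K) (diagonalForm d (productCoeffs x y)) =
      ∑ i, C (![1, algebraMap k K x, algebraMap k K y,
        algebraMap k K x * algebraMap k K y] i) * X i ^ d := by
  simp [diagonalForm, productCoeffs, Fin.sum_univ_four]

/-- The surface with coefficients `1, x, y, xy` contains a line as soon as `x` or `y` is a `d`-th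
power. -/
theorem hasLineOver_productCoeffs {k : Type*} [Field k] {d : ℕ} (hodd : Odd d) (x y : kˣ)
    (K : Type*) [Field K] [Algebra k K]
    (h : (∃ c : K, c ^ d = algebraMap k K x) ∨ ∃ c : K, c ^ d = algebraMap k K y) :
    HasLineOver (diagonalForm d (productCoeffs x y)) K := by
  rw [HasLineOver, map_diagonalForm_productCoeffs]
  rcases h with ⟨c, hc⟩ | ⟨c, hc⟩
  · refine containsLine_of_perm hodd _ (Equiv.swap 0 1 * Equiv.swap 2 3) ⟨c, ?_⟩ ⟨c, ?_⟩ <;>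
      simp [Equiv.swap_apply_def, hc, mul_comm]
  · refine containsLine_of_perm hodd _ (Equiv.swap 0 2 * Equiv.swap 1 2 * Equiv.swap 2 3)
      ⟨c, ?_⟩ ⟨c, ?_⟩ <;> simp [Equiv.swap_apply_def, hc]

/-- Over a field of characteristic zero the converse holds. The pairing `{0, 3}, {1, 2}` would
make both `xy` and `y / x` a `d`-th power, hence also `x²`, hence also `x` because `d` is odd. -/
theorem pow_of_hasLineOver_productCoeffs {k : Type*} [Field k] [CharZero k] {d : ℕ} (hd : 3 ≤ d)
    (hodd : Odd d) (x y : kˣ) (h : HasLineOver (diagonalForm d (productCoeffs x y)) k) :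
    (∃ c : k, c ^ d = x) ∨ ∃ c : k, c ^ d = y := by
  rw [HasLineOver, map_diagonalForm_productCoeffs] at h
  simp only [Algebra.algebraMap_self_apply] at h
  set b : Fin 4 → k := ![1, x, y, x * y] with hb
  have hb0 : ∀ i, b i ≠ 0 := by
    intro i
    fin_cases i <;> simp [hb]
  obtain ⟨σ, h1, h2⟩ := exists_perm_of_containsLine hd hodd b hb0 h
  have hd0 : d ≠ 0 := by lia
  have comb : ∀ i j k l : Fin 4, i ≠ j → i ≠ k → i ≠ l → j ≠ k → j ≠ l → k ≠ l →
      (s(i, j) = s(1, 0) ∨ s(k, l) = s(1, 0)) ∨ (s(i, j) = s(2, 0) ∨ s(k, l) = s(2, 0)) ∨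
      (s(i, j) = s(3, 0) ∧ s(k, l) = s(2, 1)) ∨ (s(i, j) = s(2, 1) ∧ s(k, l) = s(3, 0)) := by
    decide
  have rel : ∀ i j m n : Fin 4, PowRel d (b i) (b j) → s(i, j) = s(m, n) →
      PowRel d (b m) (b n) := by
    intro i j m n hij hs
    rcases Sym2.eq_iff.mp hs with ⟨rfl, rfl⟩ | ⟨rfl, rfl⟩
    · exact hij
    · exact hij.symm hd0 (hb0 _)
  have σne : ∀ i j, i ≠ j → σ i ≠ σ j := fun i j h h' => h (σ.injective h')
  have three : PowRel d (b 3) (b 0) → PowRel d (b 2) (b 1) → ∃ c : k, c ^ d = x := by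
    rintro ⟨c, hc⟩ ⟨e, he⟩
    simp only [hb, Matrix.cons_val, one_mul] at hc he
    obtain ⟨m, hm⟩ := hodd
    have he0 : e ≠ 0 := by
      rintro rfl
      simp [hd0] at he
    have hc0 : c ≠ 0 := by
      rintro rfl
      simp [hd0] at hc
    have hx2 : (x : k) ^ 2 = (c / e) ^ d := by
      rw [div_pow, eq_div_iff (pow_ne_zero _ he0), ← hc, he]
      ring
    refine ⟨x / (c / e) ^ m, ?_⟩
    rw [div_pow, ← pow_mul, mul_comm m d, pow_mul, ← hx2, ← pow_mul, div_eq_iff (by simp), hm]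
    ring
  rcases comb _ _ _ _ (σne 0 1 (by decide)) (σne 0 2 (by decide)) (σne 0 3 (by decide))
    (σne 1 2 (by decide)) (σne 1 3 (by decide)) (σne 2 3 (by decide)) with
    (h | h) | (h | h) | ⟨h, h'⟩ | ⟨h, h'⟩
  · obtain ⟨c, hc⟩ := rel _ _ _ _ h1 h
    exact Or.inl ⟨c, by simpa [hb] using hc.symm⟩
  · obtain ⟨c, hc⟩ := rel _ _ _ _ h2 h
    exact Or.inl ⟨c, by simpa [hb] using hc.symm⟩
  · obtain ⟨c, hc⟩ := rel _ _ _ _ h1 h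
    exact Or.inr ⟨c, by simpa [hb] using hc.symm⟩
  · obtain ⟨c, hc⟩ := rel _ _ _ _ h2 h
    exact Or.inr ⟨c, by simpa [hb] using hc.symm⟩
  · exact Or.inl (three (rel _ _ _ _ h1 h) (rel _ _ _ _ h2 h'))
  · exact Or.inl (three (rel _ _ _ _ h2 h') (rel _ _ _ _ h1 h))

/-! ### Roots in completions of number fields -/

/-- A complete ultrametric field contains an `n`-th root of every element `u` with
`‖u - 1‖ < ‖n‖ ^ 2`, and even one close to `1`: the map `x ↦ x - (x ^ n - u) / n`, a variant of
Newton's iteration with constant slope, contracts the ball of radius `‖u - 1‖ / ‖n‖` about `1`. -/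
theorem exists_pow_eq_of_norm_sub_one_lt {K : Type*} [NormedField K] [IsUltrametricDist K]
    [CompleteSpace K] {n : ℕ} {u : K} (h : ‖u - 1‖ < ‖(n : K)‖ ^ 2) :
    ∃ x : K, x ^ n = u ∧ ‖x - 1‖ < 1 := by
  have hn1 : ‖(n : K)‖ ≤ 1 := IsUltrametricDist.norm_natCast_le_one K n
  have hn0 : 0 < ‖(n : K)‖ := by
    rcases (norm_nonneg (n : K)).eq_or_lt with h0 | h0
    · rw [← h0] at h
      have := norm_nonneg (u - 1)
      norm_num at h
      linarith
    · exact h0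
  have hn : (n : K) ≠ 0 := norm_pos_iff.mp hn0
  set r : ℝ := ‖u - 1‖ / ‖(n : K)‖ with hr
  have hr0 : 0 ≤ r := by positivity
  have hrn : r < ‖(n : K)‖ := by rwa [hr, div_lt_iff₀ hn0, ← sq]
  have hr1 : r ≤ 1 := hrn.le.trans hn1
  set S : Set K := Metric.closedBall 1 r with hS
  have memS : ∀ x, x ∈ S ↔ ‖x - 1‖ ≤ r := fun x => by rw [hS, mem_closedBall_iff_norm]
  have mulS : ∀ x ∈ S, ∀ y ∈ S, x * y ∈ S := by
    intro x hx y hy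
    rw [memS] at *
    have hx1 : ‖x‖ ≤ 1 := by
      have := IsUltrametricDist.norm_add_le_max (x - 1) 1
      rw [sub_add_cancel, norm_one] at this
      exact this.trans (max_le (hx.trans hr1) le_rfl)
    rw [show x * y - 1 = x * (y - 1) + (x - 1) by ring]
    refine (IsUltrametricDist.norm_add_le_max _ _).trans (max_le ?_ hx)
    rw [norm_mul]
    exact (mul_le_of_le_one_left (norm_nonneg _) hx1).trans hy
  have oneS : (1 : K) ∈ S := by simp [memS, hr0]
  have powS : ∀ x ∈ S, ∀ m : ℕ, x ^ m ∈ S := by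
    intro x hx m
    induction m with
    | zero => simpa using oneS
    | succ m ih => rw [pow_succ]; exact mulS _ ih _ hx
  let T : K → K := fun x => x - (x ^ n - u) / n
  have hT : ∀ x ∈ S, ∀ y ∈ S, ‖T x - T y‖ ≤ r / ‖(n : K)‖ * ‖x - y‖ := by
    intro x hx y hy
    have e : T x - T y =
        (∑ i ∈ Finset.range n, (1 - x ^ i * y ^ (n - 1 - i))) / n * (x - y) := by
      rw [Finset.sum_sub_distrib, sub_div, sub_mul, div_mul_eq_mul_div (b := (n : K)) (c := x - y)
        (a := ∑ i ∈ Finset.range n, x ^ i * y ^ (n - 1 - i)), geom_sum₂_mul]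
      simp only [Finset.sum_const, Finset.card_range, nsmul_eq_mul, mul_one, div_self hn, one_mul,
        T]
      ring
    rw [e, norm_mul, norm_div]
    gcongr
    refine IsUltrametricDist.norm_sum_le_of_forall_le_of_nonneg hr0 fun i _ => ?_
    rw [norm_sub_rev, ← memS]
    exact mulS _ (powS x hx _) _ (powS y hy _)
  have hk : r / ‖(n : K)‖ < 1 := (div_lt_one hn0).mpr hrn
  have hT1 : ‖T 1 - 1‖ ≤ r := by
    simp only [T, one_pow, hr]
    rw [sub_sub_cancel_left, norm_neg, norm_div, norm_sub_rev]
  have hmaps : Set.MapsTo T S S := by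
    intro x hx
    rw [memS, ← sub_add_sub_cancel _ (T 1)]
    refine (IsUltrametricDist.norm_add_le_max _ _).trans (max_le ?_ hT1)
    exact (hT x hx 1 oneS).trans
      ((mul_le_of_le_one_left (norm_nonneg _) hk.le).trans ((memS x).mp hx))
  have hcontr : ContractingWith ⟨r / ‖(n : K)‖, by positivity⟩ (hmaps.restrict T S S) := by
    refine ⟨by exact_mod_cast hk, LipschitzWith.of_dist_le_mul fun x y => ?_⟩
    rw [Subtype.dist_eq, Subtype.dist_eq, dist_eq_norm, dist_eq_norm]
    exact hT x x.2 y y.2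
  obtain ⟨x, hxS, hx, -⟩ := hcontr.exists_fixedPoint' (Metric.isClosed_closedBall.isComplete)
    hmaps oneS (edist_ne_top _ _)
  refine ⟨x, ?_, ((memS x).mp hxS).trans_lt (hrn.trans_le hn1)⟩
  have : (x ^ n - u) / n = 0 := by simpa [T, Function.IsFixedPt] using hx
  rw [div_eq_zero_iff, sub_eq_zero] at this
  exact this.resolve_right hn

open IsDedekindDomain NumberField in
/-- If `ℓ ≡ 1 mod q³`, then at every finite place `v` either `ℓ` is a `q`-th power or the
completion contains a primitive `q`-th root of unity. When `v ∣ q` or `q ∤ N v - 1`, the element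
`ℓ` is a `q`-th power modulo a power of `v` high enough for Newton's iteration; when `v ∤ q` and
`q ∣ N v - 1`, an element of order `q` of the residue field lifts. -/
theorem exists_pow_eq_or_exists_primitiveRoot {k : Type*} [Field k] [NumberField k]
    (v : HeightOneSpectrum (𝓞 k)) {q l : ℕ} (hq : q.Prime) (hl : l.Prime)
    (hlq : l ≡ 1 [MOD q ^ 3]) :
    (∃ c : v.adicCompletion k, c ^ q = l) ∨ ∃ ζ : v.adicCompletion k, IsPrimitiveRoot ζ q := by
  let φ : 𝓞 k →+* v.adicCompletion k := (FinitePlace.embedding v).comp (algebraMap (𝓞 k) k)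
  have hlt : ∀ x, ‖φ x‖ < 1 ↔ x ∈ v.asIdeal := FinitePlace.norm_lt_one_iff_mem k v
  have heq : ∀ x, ‖φ x‖ = 1 ↔ x ∉ v.asIdeal := FinitePlace.norm_eq_one_iff_notMem k v
  have hle : ∀ x, ‖φ x‖ ≤ 1 := FinitePlace.norm_le_one k v
  have hq0 : (q : v.adicCompletion k) ≠ 0 := by
    rw [← map_natCast (algebraMap k (v.adicCompletion k)), map_ne_zero]
    exact_mod_cast hq.ne_zero
  by_cases hqv : (q : 𝓞 k) ∈ v.asIdeal
  · left
    obtain ⟨m, hm⟩ := (Nat.modEq_iff_dvd' hl.one_lt.le).mp hlq.symm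
    have hl' : (l : v.adicCompletion k) - 1 = q ^ 3 * φ m := by
      rw [map_natCast, ← Nat.cast_one, ← Nat.cast_sub hl.one_lt.le, hm]
      push_cast
      rfl
    have hqn : ‖(q : v.adicCompletion k)‖ < 1 := by
      rw [← map_natCast φ]
      exact (hlt _).mpr hqv
    obtain ⟨x, hx, -⟩ := exists_pow_eq_of_norm_sub_one_lt
      (K := v.adicCompletion k) (n := q) (u := l) (by
        rw [hl', norm_mul, norm_pow, pow_succ]
        have h0 : 0 < ‖(q : v.adicCompletion k)‖ ^ 2 := pow_pos (norm_pos_iff.mpr hq0) 2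
        calc _ ≤ ‖(q : v.adicCompletion k)‖ ^ 2 * ‖(q : v.adicCompletion k)‖ :=
              mul_le_of_le_one_right (by positivity) (hle _)
          _ < _ := mul_lt_of_lt_one_right h0 hqn)
    exact ⟨x, hx⟩
  have hqn : ‖(q : v.adicCompletion k)‖ = 1 := by
    rw [← map_natCast φ]
    exact (heq _).mpr hqv
  -- away from `q`, a congruence `a ^ q ≡ b` between units lifts to an equality
  have lift : ∀ a b : 𝓞 k, a ∉ v.asIdeal → a ^ q - b ∈ v.asIdeal →
      ∃ x : v.adicCompletion k, (φ a * x) ^ q = φ b ∧ ‖x - 1‖ < 1 := by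
    intro a b ha hab
    have ha1 := (heq a).mpr ha
    have ha0 : φ a ≠ 0 := norm_pos_iff.mp (by rw [ha1]; exact one_pos)
    obtain ⟨x, hx, hx1⟩ := exists_pow_eq_of_norm_sub_one_lt
      (K := v.adicCompletion k) (n := q) (u := φ b / φ a ^ q) (by
        rw [div_sub_one (pow_ne_zero _ ha0), norm_div, norm_pow, ha1, hqn, norm_sub_rev,
          ← map_pow, ← map_sub]
        simpa using (hlt _).mpr hab)
    exact ⟨x, by rw [mul_pow, hx, mul_div_cancel₀ _ (pow_ne_zero _ ha0)], hx1⟩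
  have hmax : v.asIdeal.IsMaximal := v.isMaximal
  let : Field (𝓞 k ⧸ v.asIdeal) := Ideal.Quotient.field _
  have : Finite (𝓞 k ⧸ v.asIdeal) := Ideal.finiteQuotientOfFreeOfNeBot _ v.ne_bot
  have : Fintype (𝓞 k ⧸ v.asIdeal) := Fintype.ofFinite _
  by_cases hN : q ∣ Nat.card (𝓞 k ⧸ v.asIdeal)ˣ
  · right
    have : Fact q.Prime := ⟨hq⟩
    obtain ⟨g, hg⟩ := exists_prime_orderOf_dvd_card' q hN
    obtain ⟨a, ha⟩ := Ideal.Quotient.mk_surjective (g : 𝓞 k ⧸ v.asIdeal)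
    have hav : a ∉ v.asIdeal := by
      rw [← Ideal.Quotient.eq_zero_iff_mem, ha]
      exact g.ne_zero
    have haq : a ^ q - 1 ∈ v.asIdeal := by
      rw [← Ideal.Quotient.eq_zero_iff_mem, map_sub, map_pow, ha, map_one,
        ← Units.val_pow_eq_pow_val, ← hg, pow_orderOf_eq_one, Units.val_one, sub_self]
    obtain ⟨x, hx, hx1⟩ := lift a 1 hav haq
    refine ⟨φ a * x, ?_⟩
    rw [← orderOf_eq_prime (p := q) (hx.trans (map_one φ)) ?_]
    · exact IsPrimitiveRoot.orderOf _
    · intro h1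
      have ha1 : a - 1 ∈ v.asIdeal := by
        rw [← hlt, map_sub, map_one, ← h1, ← neg_sub, norm_neg,
          show φ a * x - φ a = φ a * (x - 1) by ring, norm_mul]
        exact (mul_le_of_le_one_left (norm_nonneg _) (hle a)).trans_lt hx1
      rw [← Ideal.Quotient.eq_zero_iff_mem, map_sub, ha, map_one, sub_eq_zero,
        Units.val_eq_one] at ha1
      rw [ha1, orderOf_one] at hg
      exact hq.one_lt.ne hg
  · left
    have hlv : (l : 𝓞 k) ∉ v.asIdeal := by
      -- otherwise `N v` is a power of `ℓ`, hence congruent to `1` modulo `q`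
      intro hlv
      rw [← Ideal.Quotient.eq_zero_iff_mem, map_natCast] at hlv
      have : Fact l.Prime := ⟨hl⟩
      have : CharP (𝓞 k ⧸ v.asIdeal) l := (CharP.charP_iff_prime_eq_zero hl).mpr hlv
      obtain ⟨n, -, hn⟩ := FiniteField.card (𝓞 k ⧸ v.asIdeal) l
      apply hN
      rw [Nat.card_units, Nat.card_eq_fintype_card, hn,
        ← Nat.modEq_iff_dvd' (Nat.one_le_pow _ _ hl.pos)]
      have := (hlq.of_dvd (dvd_pow_self q three_ne_zero)).pow (n : ℕ)
      rw [one_pow] at this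
      exact this.symm
    have hlv0 : Ideal.Quotient.mk v.asIdeal (l : 𝓞 k) ≠ 0 := by
      rwa [Ne, Ideal.Quotient.eq_zero_iff_mem]
    obtain ⟨g, hg⟩ := (powCoprime ((hq.coprime_iff_not_dvd.mpr hN).symm)).surjective
      (Units.mk0 _ hlv0)
    obtain ⟨a, ha⟩ := Ideal.Quotient.mk_surjective (g : 𝓞 k ⧸ v.asIdeal)
    obtain ⟨x, hx, -⟩ := lift a l (by
      rw [← Ideal.Quotient.eq_zero_iff_mem, ha]
      exact g.ne_zero) (by
      rw [← Ideal.Quotient.eq_zero_iff_mem, map_sub, map_pow, ha, sub_eq_zero]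
      exact congrArg Units.val hg)
    exact ⟨_, hx.trans (map_natCast φ l)⟩

open NumberField in
/-- A natural number has roots of every order in every archimedean completion. -/
theorem exists_pow_eq_natCast_completion {k : Type*} [Field k] [NumberField k]
    (v : InfinitePlace k) {n : ℕ} (hn : n ≠ 0) (l : ℕ) : ∃ c : v.Completion, c ^ n = l := by
  rcases v.isReal_or_isComplex with hv | hv
  · let e := InfinitePlace.Completion.ringEquivRealOfIsReal hv
    refine ⟨e.symm ((l : ℝ) ^ ((n : ℝ)⁻¹)), ?_⟩
    rw [← map_pow, Real.rpow_inv_natCast_pow (Nat.cast_nonneg l) hn, map_natCast]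
  · let e := InfinitePlace.Completion.ringEquivComplexOfIsComplex hv
    obtain ⟨z, hz⟩ := IsAlgClosed.exists_pow_nat_eq (l : ℂ) (Nat.pos_of_ne_zero hn)
    exact ⟨e.symm z, by rw [← map_pow, hz, map_natCast]⟩

/-! ### Powers in cyclotomic fields -/

/-- If the cyclic extension `K / k` has degree divisible by `n` and `k` contains the `n`-th roots
of unity, then each of them is an eigenvalue of a generator of the Galois group; for an
eigenvector `β : K` with a primitive `n`-th root of unity as eigenvalue, the power `β ^ n` lies in
`k` and is not an `n`-th power there. -/
theorem exists_pow_mem_not_pow {k K : Type*} [Field k] [Field K] [Algebra k K]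
    [FiniteDimensional k K] [IsGalois k K] [IsCyclic Gal(K/k)] {n : ℕ} (hn : 1 < n)
    (hdvd : n ∣ Module.finrank k K) {ζ : k} (hζ : IsPrimitiveRoot ζ n) :
    ∃ θ : k, θ ≠ 0 ∧ (∃ β : K, β ^ n = algebraMap k K θ) ∧ ¬ ∃ c : k, c ^ n = θ := by
  obtain ⟨σ, hσ⟩ := IsCyclic.exists_generator (α := Gal(K/k))
  have hroot : (minpoly k σ.toLinearMap).IsRoot ζ := by
    have hcard := orderOf_eq_card_of_forall_mem_zpowers hσ
    rw [IsGalois.card_aut_eq_finrank] at hcard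
    simpa [minpoly_algEquiv_toLinearMap σ (isOfFinOrder_of_finite σ), hcard, sub_eq_zero] using
      (hζ.pow_eq_one_iff_dvd _).mpr hdvd
  obtain ⟨β, hβ⟩ := (Module.End.hasEigenvalue_of_isRoot hroot).exists_hasEigenvector
  have hβ0 : β ≠ 0 := hβ.2
  replace hβ : σ β = algebraMap k K ζ * β := by
    have := hβ.apply_eq_smul
    rwa [AlgEquiv.toLinearMap_apply, Algebra.smul_def] at this
  have hfix : ∀ x : K, σ x = x → x ∈ Set.range (algebraMap k K) := by
    intro x hx
    rw [IsGalois.mem_range_algebraMap_iff_fixed]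
    intro τ
    have : Subgroup.zpowers σ ≤ MulAction.stabilizer Gal(K/k) x := by
      rw [Subgroup.zpowers_le]
      exact hx
    exact this (hσ τ)
  have hpow : σ (β ^ n) = β ^ n := by
    rw [map_pow, hβ, mul_pow, ← map_pow, hζ.pow_eq_one, map_one, one_mul]
  obtain ⟨θ, hθ⟩ := hfix _ hpow
  refine ⟨θ, ?_, ⟨β, hθ.symm⟩, ?_⟩
  · rintro rfl
    rw [map_zero] at hθ
    exact pow_ne_zero n hβ0 hθ.symm
  · rintro ⟨c, hc⟩
    have hn0 : n ≠ 0 := by lia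
    have : NeZero n := ⟨hn0⟩
    rw [← hc, map_pow] at hθ
    have hc0 : algebraMap k K c ≠ 0 := by
      intro h0
      rw [h0, zero_pow hn0] at hθ
      exact pow_ne_zero n hβ0 hθ.symm
    obtain ⟨i, -, hi⟩ := (hζ.map_of_injective (algebraMap k K).injective).eq_pow_of_pow_eq_one
      (ξ := β / algebraMap k K c) (by rw [div_pow, hθ, div_self (pow_ne_zero n hβ0)])
    rw [eq_div_iff hc0] at hi
    have hfixed : σ β = β := by
      rw [← hi, ← map_pow, ← map_mul, AlgEquiv.commutes]
    have h1 : algebraMap k K ζ = 1 := mul_right_cancel₀ hβ0 (by rw [← hβ, hfixed, one_mul])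
    rw [map_eq_one_iff _ (algebraMap k K).injective] at h1
    rw [h1] at hζ
    exact hn.ne' (hζ.unique IsPrimitiveRoot.one)

/-- Let `d = p ^ (n + 1) * m` with `m` prime to `p`. When `k` contains the `p ^ (n + 1)`-th roots of
unity, an element is a `p`-th power as soon as its `d / p`-th power is a `d`-th power. -/
theorem exists_pow_eq_of_pow_eq {k : Type*} [Field k] {p n m : ℕ} (hp : p.Prime)
    (hm : p.Coprime m) {ζ : k} (hζ : IsPrimitiveRoot ζ (p ^ (n + 1))) {θ c : k} (hθ : θ ≠ 0)
    (h : c ^ (p ^ (n + 1) * m) = θ ^ (p ^ n * m)) : ∃ b : k, b ^ p = θ := by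
  have hm0 : m ≠ 0 := by
    rintro rfl
    exact hp.one_lt.ne' (by simpa using hm)
  have : NeZero (p ^ (n + 1)) := ⟨pow_ne_zero _ hp.ne_zero⟩
  have hc0 : c ≠ 0 := by
    rintro rfl
    rw [zero_pow (mul_ne_zero (pow_ne_zero _ hp.ne_zero) hm0)] at h
    exact pow_ne_zero _ hθ h.symm
  set ε := θ / c ^ p with hε
  have hε0 : ε ≠ 0 := by positivity
  have hε1 : (ε ^ m) ^ (p ^ n) = 1 := by
    rw [hε, ← pow_mul, mul_comm m, div_pow, ← h, ← pow_mul, ← mul_assoc, ← pow_succ',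
      div_self (pow_ne_zero _ hc0)]
  -- `ε ^ m` is a `p`-th power, as a root of unity of order dividing `p ^ n`
  have hζp : IsPrimitiveRoot (ζ ^ p) (p ^ n) :=
    hζ.pow (pow_pos hp.pos _) (pow_succ' p n)
  have : NeZero (p ^ n) := ⟨pow_ne_zero _ hp.ne_zero⟩
  obtain ⟨i, -, hi⟩ := hζp.eq_pow_of_pow_eq_one hε1
  -- and so is `ε`, as `m` is prime to `p`
  have hbez : (1 : ℤ) = p * Nat.gcdA p m + m * Nat.gcdB p m := by
    rw [← Nat.gcd_eq_gcd_ab, hm.gcd_eq_one, Nat.cast_one]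
  refine ⟨c * (ε ^ Nat.gcdA p m * (ζ ^ i) ^ Nat.gcdB p m), ?_⟩
  have : (ε ^ Nat.gcdA p m * (ζ ^ i) ^ Nat.gcdB p m) ^ p = ε := by
    conv_rhs => rw [← zpow_one ε, hbez, zpow_add₀ hε0, zpow_mul, zpow_mul, zpow_natCast,
      zpow_natCast, ← hi]
    rw [mul_pow]
    congr 1
    · rw [← zpow_natCast, ← zpow_natCast, ← zpow_mul, ← zpow_mul, mul_comm]
    · rw [← zpow_natCast, ← zpow_mul, mul_comm, zpow_mul, zpow_natCast, ← pow_mul, ← pow_mul,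
        mul_comm i p]
  rw [mul_pow, this, hε, mul_div_cancel₀ _ (pow_ne_zero _ hc0)]

/-- Taking norms, a prime number whose `d / q`-th power is a `d`-th power in a number field forces
`q` to divide the degree of the field. -/
theorem dvd_finrank_of_pow_eq {k : Type*} [Field k] [NumberField k] {l q e : ℕ} (hl : l.Prime)
    (he : e ≠ 0) {c : k} (h : c ^ (q * e) = (l : k) ^ e) : q ∣ Module.finrank ℚ k := by
  have : Fact l.Prime := ⟨hl⟩
  have hN := congrArg (Algebra.norm ℚ) h
  rw [map_pow, map_pow, ← map_natCast (algebraMap ℚ k), Algebra.norm_algebraMap, ← pow_mul] at hN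
  have hv := congrArg (padicValRat l) hN
  have self : padicValRat l (l : ℚ) = 1 := by simp
  rw [padicValRat.pow, padicValRat.pow, self] at hv
  push_cast at hv
  have : (q : ℤ) ∣ Module.finrank ℚ k :=
    ⟨padicValRat l (Algebra.norm ℚ c), mul_right_cancel₀ (Nat.cast_ne_zero.mpr he : (e : ℤ) ≠ 0)
      (by linear_combination -hv)⟩
  exact_mod_cast this

/-- For coprime `m` and `q`, adjoining the `q`-th roots of unity to a cyclotomic field `ℚ(μ_m)`
gives an extension of degree `φ(q)`. -/
theorem finrank_cyclotomic_of_coprime {m q : ℕ} [NeZero m] [NeZero q] (hmq : m.Coprime q)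
    (k K : Type*) [Field k] [NumberField k] [IsCyclotomicExtension {m} ℚ k] [Field K] [Algebra k K]
    [IsCyclotomicExtension {q} k K] : Module.finrank k K = q.totient := by
  have : CharZero K := charZero_of_injective_algebraMap (algebraMap k K).injective
  have hfin : FiniteDimensional k K := IsCyclotomicExtension.finiteDimensional {q} k K
  have : FiniteDimensional ℚ K := FiniteDimensional.trans ℚ k K
  have h1 : IsCyclotomicExtension ({m} ∪ {q}) ℚ K :=
    IsCyclotomicExtension.trans {m} {q} ℚ k K (algebraMap k K).injective
  obtain ⟨ζm, hζm⟩ := IsCyclotomicExtension.exists_isPrimitiveRoot ℚ K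
    (show m ∈ ({m} ∪ {q} : Set ℕ) by simp) (NeZero.ne m)
  obtain ⟨ζq, hζq⟩ := IsCyclotomicExtension.exists_isPrimitiveRoot ℚ K
    (show q ∈ ({m} ∪ {q} : Set ℕ) by simp) (NeZero.ne q)
  have hζ := hζm.pow_mul_pow_lcm hζq (NeZero.ne m) (NeZero.ne q)
  rw [hmq.lcm_eq_mul] at hζ
  have h2 : IsCyclotomicExtension ({m * q} ∪ {m} ∪ {q}) ℚ K := by
    rw [Set.union_assoc, Set.union_comm]
    exact IsCyclotomicExtension.union_of_isPrimitiveRoot _ _ _ hζ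
  have hmq0 : m * q ≠ 0 := mul_ne_zero (NeZero.ne m) (NeZero.ne q)
  rw [← IsCyclotomicExtension.iff_union_of_dvd _ _ ⟨m * q, by simp, hmq0, dvd_mul_left q m⟩,
    ← IsCyclotomicExtension.iff_union_of_dvd _ _ ⟨m * q, by simp, hmq0, dvd_mul_right m q⟩] at h2
  have : NeZero (m * q) := ⟨hmq0⟩
  have e1 := IsCyclotomicExtension.Rat.finrank (m * q) K
  have e2 := IsCyclotomicExtension.Rat.finrank m k
  rw [← Module.finrank_mul_finrank ℚ k K, e2, Nat.totient_mul hmq] at e1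
  exact Nat.eq_of_mul_eq_mul_left (Nat.totient_pos.mpr (NeZero.pos m)) e1

/-- An element of `k` which is an `n`-th power in `k(μ_q)` is one in every field extension of `k`
containing the `q`-th roots of unity. -/
theorem exists_pow_eq_of_cyclotomic {k K L : Type*} [Field k] [Field K] [Field L] [Algebra k K]
    [Algebra k L] {q : ℕ} [NeZero q] [IsCyclotomicExtension {q} k K] {ζ : L}
    (hζ : IsPrimitiveRoot ζ q) {n : ℕ} {θ : k} {β : K} (hβ : β ^ n = algebraMap k K θ) :
    ∃ c : L, c ^ n = algebraMap k L θ := by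
  have := IsCyclotomicExtension.isSplittingField_X_pow_sub_one q k K
  let f : K →ₐ[k] L := Polynomial.IsSplittingField.lift K (Polynomial.X ^ q - 1 : Polynomial k) (by
    simpa using Polynomial.X_pow_sub_one_splits hζ)
  exact ⟨f β, by rw [← map_pow, hβ, f.commutes]⟩

/-! ### The counterexample -/

/-- The counterexample over any model `k` of `ℚ(μ_{p^n})`: its coefficients are `1, x, y, xy` with
`x = θ ^ (d / p)` and `y = ℓ ^ (d / q)`, where `θ` is a Kummer generator of the subextension of
degree `p` of `k(μ_q) / k`, and `ℓ ≡ 1 mod q³` is a prime number. -/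
theorem exists_failsHasseForLines {d p q : ℕ} (hd : 3 ≤ d) (hodd : Odd d) (hp : p.Prime)
    (hq : q.Prime) (hpd : p ∣ d) (hqd : q ∣ d) (hpq : q ≡ 1 [MOD p]) (k : Type*) [Field k]
    [NumberField k] [hk : IsCyclotomicExtension {p ^ padicValNat p d} ℚ k] :
    ∃ a : Fin 4 → kˣ, FailsHasseForLines (diagonalForm d a) := by
  have hd0 : d ≠ 0 := by lia
  have hpq1 : p ∣ q - 1 := (Nat.modEq_iff_dvd' hq.one_lt.le).mp hpq.symm
  have hlt : p < q := (Nat.le_of_dvd (Nat.sub_pos_of_lt hq.one_lt) hpq1).trans_lt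
    (Nat.sub_lt hq.pos one_pos)
  obtain ⟨n, hn⟩ : ∃ n, padicValNat p d = n + 1 := by
    have : Fact p.Prime := ⟨hp⟩
    exact ⟨padicValNat p d - 1, (Nat.sub_add_cancel (one_le_padicValNat_of_dvd hd0 hpd)).symm⟩
  obtain ⟨m, hm, hdm⟩ : ∃ m, p.Coprime m ∧ d = p ^ (n + 1) * m := by
    refine ⟨d / p ^ (n + 1), ?_, ?_⟩
    · rw [← hn, ← Nat.factorization_def d hp]
      exact Nat.coprime_ordCompl hp hd0
    · rw [← hn, ← Nat.factorization_def d hp, Nat.ordProj_mul_ordCompl_eq_self]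
  rw [hn] at hk
  have hP0 : NeZero (p ^ (n + 1)) := ⟨pow_ne_zero _ hp.ne_zero⟩
  have hQ0 : NeZero q := ⟨hq.ne_zero⟩
  have hcop : (p ^ (n + 1)).Coprime q :=
    Nat.Coprime.pow_left _ ((Nat.coprime_primes hp hq).mpr hlt.ne)
  obtain ⟨ζ, hζ⟩ := IsCyclotomicExtension.exists_isPrimitiveRoot ℚ k
    (Set.mem_singleton (p ^ (n + 1))) hP0.ne
  let K := CyclotomicField q k
  have hdeg : Module.finrank k K = q - 1 := by
    rw [finrank_cyclotomic_of_coprime hcop k K, Nat.totient_prime hq]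
  have : FiniteDimensional k K := IsCyclotomicExtension.finiteDimensional {q} k K
  have : IsGalois k K := IsCyclotomicExtension.isGalois {q} k K
  have : IsCyclic Gal(K/k) := by
    have : Fact q.Prime := ⟨hq⟩
    obtain ⟨ξ, hξ⟩ := IsCyclotomicExtension.exists_isPrimitiveRoot k K
      (Set.mem_singleton q) hq.ne_zero
    exact isCyclic_of_injective _ (hξ.autToPow_injective k)
  have hζp : IsPrimitiveRoot (ζ ^ p ^ n) p :=
    hζ.pow (pow_pos hp.pos _) (pow_succ p n)
  obtain ⟨θ, hθ0, ⟨β, hβ⟩, hθ⟩ := exists_pow_mem_not_pow (K := K) hp.one_lt (hdeg ▸ hpq1) hζp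
  obtain ⟨l, hl, -, hlq⟩ := Nat.exists_prime_gt_modEq_one 0 (pow_ne_zero 3 hq.ne_zero)
  obtain ⟨e, he⟩ := hqd
  have he0 : e ≠ 0 := by
    rintro rfl
    exact hd0 he
  have hdp : d = p * (p ^ n * m) := by rw [hdm, pow_succ']; ring
  have hl0 : (l : k) ≠ 0 := Nat.cast_ne_zero.mpr hl.ne_zero
  let x : kˣ := Units.mk0 (θ ^ (p ^ n * m)) (pow_ne_zero _ hθ0)
  let y : kˣ := Units.mk0 ((l : k) ^ e) (pow_ne_zero _ hl0)
  have ypow : ∀ (L : Type _) [Field L] [Algebra k L], (∃ c : L, c ^ q = l) →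
      HasLineOver (diagonalForm d (productCoeffs x y)) L := by
    rintro L _ _ ⟨c, hc⟩
    exact hasLineOver_productCoeffs hodd x y L (.inr ⟨c, by
      simp only [y, he, Units.val_mk0, map_pow, map_natCast, pow_mul, hc]⟩)
  refine ⟨productCoeffs x y, fun v => ?_, fun v => ?_, fun h => ?_⟩
  · exact ypow _ (exists_pow_eq_natCast_completion v hq.ne_zero l)
  · rcases exists_pow_eq_or_exists_primitiveRoot v hq hl hlq with hc | ⟨ξ, hξ⟩
    · exact ypow _ hc
    · obtain ⟨c, hc⟩ := exists_pow_eq_of_cyclotomic hξ hβ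
      exact hasLineOver_productCoeffs hodd x y _ (.inl ⟨c, by simp [x, hdp, pow_mul, hc]⟩)
  · rcases pow_of_hasLineOver_productCoeffs hd hodd x y h with ⟨c, hc⟩ | ⟨c, hc⟩
    · rw [hdm] at hc
      exact hθ (exists_pow_eq_of_pow_eq hp hm hζ hθ0 hc)
    · rw [he] at hc
      have hdvd := dvd_finrank_of_pow_eq hl he0 hc
      rw [IsCyclotomicExtension.Rat.finrank (p ^ (n + 1)) k, Nat.totient_prime_pow_succ hp,
        hq.dvd_mul] at hdvd
      rcases hdvd with h1 | h1
      · exact hlt.ne' ((Nat.prime_dvd_prime_iff_eq hq hp).mp (hq.dvd_of_dvd_pow h1))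
      · have := Nat.le_of_dvd (Nat.sub_pos_of_lt hp.one_lt) h1
        lia

end DiagonalSurface

theorem theorem3 (d : ℕ) (hd : 3 ≤ d) (hodd : Odd d) (p q : ℕ) (hp : p.Prime) (hq : q.Prime)
    (hpd : p ∣ d) (hqd : q ∣ d) (hpq : q ≡ 1 [MOD p]) :
    ∃ (k : Type) (_ : Field k) (_ : NumberField k),
      IsCyclotomicExtension {p ^ padicValNat p d} ℚ k ∧
      ∃ a : Fin 4 → kˣ,
        DiagonalSurface.FailsHasseForLines (DiagonalSurface.diagonalForm d a) := by
  have : NeZero (p ^ padicValNat p d) := ⟨pow_ne_zero _ hp.ne_zero⟩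
  -- passed explicitly below: the two `ℚ`-algebra structures on the cyclotomic field agree only
  -- after unfolding, which instance search does not attempt
  have hk := CyclotomicField.isCyclotomicExtension (p ^ padicValNat p d) ℚ
  exact ⟨CyclotomicField (p ^ padicValNat p d) ℚ, inferInstance, inferInstance, hk,
    DiagonalSurface.exists_failsHasseForLines hd hodd hp hq hpd hqd hpq _ (hk := hk)⟩
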